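/- For a word $\tau$ of distinct integers of length $k$, let $\mathrm{red}(\tau)$ be the permutation of $\{1,\dots,k\}$ whose entries are in the same relative order. For a permutation $\sigma$ of length $m$, a $k$-cluster of length $n$ with respect to $\sigma$ (where $k\ge 1$) is a pair $(\pi,(i_1,\dots,i_k))$ such that $\pi$ is a permutation of length $n$, $1=i_1<i_2<\dots<i_k=n-m+1$, $\mathrm{red}(\pi_{i_j}\pi_{i_j+1}\cdots\pi_{i_j+m-1})=\sigma$ for each $1\le j\le k$, and $i_{j+1}\le i_j+m-1$ for each $1\le j\le k-1$. Let $r_{n,k}$ be the number of $k$-clusters of length $n$ with respect to $\sigma$, and let $\widehat R_\sigma(t,x)=\sum_{n,k} r_{n,k}\,t^k x^n$ be their ordinary generating function. Theorem. Let $s,m$ be integers with $s+2\le m\le 2s$, and let $\sigma=1\,3\,4\cdots(s+1)\,2\,(s+2)(s+3)\cdots m$. Then, as formal power series in $t$ and $x$, $$\widehat R_\sigma(t,x)=\frac{x^{m-s}\,\bigl(B(tx^s)-1\bigr)}{1-(x+x^2+\dots+x^{m-s-1})\bigl(B(tx^s)-1\bigr)},\qquad B(x)=\sum_{k\ge 0}\frac{1}{(s-1)k+1}\binom{sk}{k}x^k.$$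 -/

import Mathlib

/-- The reduction of a word `τ` of distinct numbers, with letters numbered from `0`: the entry at
position `a` is replaced by its rank, the number of entries that are smaller. -/
def reduction {k : ℕ} (τ : Fin k → ℕ) (a : Fin k) : ℕ :=
  (Finset.univ.filter fun b : Fin k => τ b < τ a).card

/-- The pattern `σ` occurs in `π` consecutively at the positions `p, p + 1, …, p + m - 1`
(permutations of length `n` are permutations of `Fin n`; positions and values start at `0`). -/
def OccursAt {m n : ℕ} (σ : Equiv.Perm (Fin m)) (π : Equiv.Perm (Fin n)) (p : ℕ) : Prop :=
  ∃ h : p + m ≤ n,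
    ∀ a : Fin m, reduction (fun b : Fin m => (π ⟨p + b, by omega⟩ : ℕ)) a = (σ a : ℕ)

/-- `(π; i₁, …, i_k)` is a `k`-cluster of length `n` with respect to `σ` (with zero-based starting
positions, so that the first one is `0` and the last one is `n - m`). A cluster has at least one
marked occurrence. -/
structure IsCluster {m n k : ℕ} (σ : Equiv.Perm (Fin m)) (π : Equiv.Perm (Fin n))
    (i : Fin k → Fin n) : Prop where
  pos : 0 < k
  first : ∀ j : Fin k, (j : ℕ) = 0 → (i j : ℕ) = 0
  increasing : StrictMono i
  last : ∀ j : Fin k, (j : ℕ) + 1 = k → (i j : ℕ) + m = n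
  occurs : ∀ j : Fin k, OccursAt σ π (i j)
  overlap : ∀ j j' : Fin k, (j' : ℕ) = j + 1 → (i j' : ℕ) < i j + m

/-- The number `r_{n,k}` of `k`-clusters of length `n` with respect to `σ`. -/
noncomputable def clusterNumber {m : ℕ} (σ : Equiv.Perm (Fin m)) (n k : ℕ) : ℕ :=
  Nat.card {c : Equiv.Perm (Fin n) × (Fin k → Fin n) // IsCluster σ c.1 c.2}

/-- The variable `t`, marking the number of marked occurrences. -/
noncomputable def tVar : MvPowerSeries (Fin 2) ℚ := MvPowerSeries.X 0

/-- The variable `x`, marking the length. -/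
noncomputable def xVar : MvPowerSeries (Fin 2) ℚ := MvPowerSeries.X 1

/-- The ordinary generating function `∑ r_{n,k} t^k x^n` of the cluster numbers of `σ`. -/
noncomputable def clusterOGF {m : ℕ} (σ : Equiv.Perm (Fin m)) : MvPowerSeries (Fin 2) ℚ :=
  fun d => (clusterNumber σ (d 1) (d 0) : ℚ)

/-- The permutation `1 3 4 ⋯ (s+1) 2 (s+2) (s+3) ⋯ m`. With entries and positions numbered from `0`
it reads `0, 2, 3, …, s, 1, s+1, s+2, …, m-1`. -/
noncomputable def pattern1324 (s m : ℕ) (h : s + 2 ≤ m) : Equiv.Perm (Fin m) :=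
  Equiv.ofBijective
    (fun a : Fin m =>
      if h0 : (a : ℕ) = 0 then ⟨0, by omega⟩
      else if h1 : (a : ℕ) < s then ⟨(a : ℕ) + 1, by omega⟩
      else if h2 : (a : ℕ) = s then ⟨1, by omega⟩
      else a)
    (Finite.injective_iff_bijective.mp (by
      intro a b hab
      rw [Fin.ext_iff] at hab ⊢
      dsimp only at hab
      split_ifs at hab <;> (try simp only at hab) <;> omega))

/-- The series `B(x) = ∑ₖ 1/((s-1)k+1) * binom(sk, k) * x^k`. -/
noncomputable def fussCatalanSeries (s : ℕ) : PowerSeries ℚ :=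
  PowerSeries.mk fun k => 1 / (((s : ℚ) - 1) * k + 1) * ((s * k).choose k : ℚ)

/-- The bivariate formal power series `B(t x^s)`. -/
noncomputable def fussCatalanSubst (s : ℕ) : MvPowerSeries (Fin 2) ℚ :=
  (fussCatalanSeries s).subst (tVar * xVar ^ s)

/-- The substitution in `fussCatalanSubst` is legitimate. -/
theorem hasSubst_tVar_mul_xVar_pow (s : ℕ) : PowerSeries.HasSubst (tVar * xVar ^ s) := by
  apply PowerSeries.HasSubst.of_constantCoeff_zero
  simp [tVar]

/-! Let the marked occurrences start at `p j`, and let `w j` be the entry at position `p j + s`, the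
displaced letter of the pattern. Two consecutive windows are at least `s` apart, since a shorter
shift puts the descent of one into an increasing run of the next. So the permutation increases off
the positions `p j + s`, and it is determined by the `w j`, which also increase. Counting ranks in
this shuffle turns the occurrence conditions into: `w 0 = 1`, `w j ≤ p j + 1`, and equality after
any gap other than `s` (`isCluster_iff`).

The slack `p j + 1 - w j` then performs a walk: a gap `s` leads from slack `u` to any slack below `u
+ s`, a longer gap (less than `m`) to slack `0`. With `z = t x^s` and `X = x + ... + x^(m-s-1)`, the
series `F u` of walks from slack `u` satisfies `F u = 1 + z ∑_{v<u+s} F v + z X F 0`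
(`walkSeries_eq`). The powers of `B = B(z)` satisfy `B^(v+1) = B^v + z B^(v+s)`, so `F u = B^(u+s) /
(1 - X (B - 1))` (`linear_system_solution`). The clusters are counted by `t x^m F 0`, and `z B^s = B
- 1`. -/

/-! ### Raney numbers and powers of the Fuss-Catalan series -/

/-- The coefficient of `x ^ k` in `B(x) ^ v`, where `B` is the Fuss-Catalan series of order `s`. -/
def raneyCoeff (s v : ℕ) : ℕ → ℚ
  | 0 => 1
  | k + 1 => v / (k + 1) * ((s * (k + 1) + v - 1).choose k : ℚ)

/-- The generating series of the Raney numbers. -/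
noncomputable def raneySeries (s v : ℕ) : PowerSeries ℚ := PowerSeries.mk (raneyCoeff s v)

/-- This is the coefficient form of `B^(v+1) = B^v + x B^(v+s)`. It is proved on binomials, so the
functional equation of `B` is never needed: the three upper indices are `M + 1`, `M`, `M`, and
everything reduces to one binomial. -/
theorem raneyCoeff_succ_succ {s : ℕ} (hs : 0 < s) (v k : ℕ) :
    raneyCoeff s (v + 1) (k + 1) = raneyCoeff s v (k + 1) + raneyCoeff s (v + s) k := by
  cases k with
  | zero => simp [raneyCoeff]
  | succ k =>
    obtain ⟨M, hM⟩ : ∃ M, s * (k + 2) + v = M + 1 :=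
      ⟨s * (k + 2) + v - 1, (Nat.succ_pred_eq_of_pos (by positivity)).symm⟩
    have hkM : k ≤ M := by
      have := Nat.mul_le_mul_right (k + 2) hs
      omega
    have e1 : s * (k + 1 + 1) + (v + 1) - 1 = M + 1 := by rw [← hM]; rfl
    have e2 : s * (k + 1 + 1) + v - 1 = M := by omega
    have e3 : s * (k + 1) + (v + s) - 1 = M := by
      have : s * (k + 1) + (v + s) = s * (k + 2) + v := by ring
      omega
    have hc : (M.choose (k + 1) : ℚ) * (k + 1) = M.choose k * (M - k) := by
      have := Nat.choose_succ_right_eq M k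
      rw [← Nat.cast_sub hkM]
      exact_mod_cast this
    have hM' : (s : ℚ) * (k + 2) + v = M + 1 := by exact_mod_cast hM
    have h1 : (k : ℚ) + 1 ≠ 0 := by positivity
    have h2 : (k : ℚ) + 1 + 1 ≠ 0 := by positivity
    have hc' : (M.choose (k + 1) : ℚ) = M.choose k * (M - k) / (k + 1) := by
      rw [← hc]; field_simp
    have hM'' : (M : ℚ) = s * (k + 2) + v - 1 := by linarith
    simp only [raneyCoeff, e1, e2, e3, Nat.choose_succ_succ' M k]
    push_cast
    rw [hc', hM'']
    field_simp
    ring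

theorem raneySeries_succ {s : ℕ} (hs : 0 < s) (v : ℕ) :
    raneySeries s (v + 1) = raneySeries s v + PowerSeries.X * raneySeries s (v + s) := by
  ext k
  cases k with
  | zero => simp [raneySeries, raneyCoeff]
  | succ k =>
    simp only [raneySeries, map_add, PowerSeries.coeff_succ_X_mul, PowerSeries.coeff_mk]
    exact raneyCoeff_succ_succ hs v k

theorem raneySeries_zero (s : ℕ) : raneySeries s 0 = 1 := by
  ext k
  cases k <;> simp [raneySeries, raneyCoeff, PowerSeries.coeff_one]

theorem raneySeries_one {s : ℕ} (hs : 0 < s) : raneySeries s 1 = fussCatalanSeries s := by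
  ext k
  simp only [raneySeries, fussCatalanSeries, PowerSeries.coeff_mk]
  cases k with
  | zero => simp [raneyCoeff]
  | succ k =>
    have hkM : k ≤ s * (k + 1) := by
      have := Nat.mul_le_mul_right (k + 1) hs
      omega
    have hc : ((s * (k + 1)).choose (k + 1) : ℚ) * (k + 1) =
        (s * (k + 1)).choose k * (s * (k + 1) - k) := by
      have := Nat.choose_succ_right_eq (s * (k + 1)) k
      have h2 : ((s * (k + 1) - k : ℕ) : ℚ) = s * (k + 1) - k := by
        rw [Nat.cast_sub hkM]; push_cast; rfl
      rw [← h2]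
      exact_mod_cast this
    have h1 : (k : ℚ) + 1 ≠ 0 := by positivity
    have hs' : (1 : ℚ) ≤ s := by exact_mod_cast hs
    have h2 : ((s : ℚ) - 1) * ((k + 1 : ℕ) : ℚ) + 1 ≠ 0 := by
      have : 0 ≤ ((s : ℚ) - 1) * ((k + 1 : ℕ) : ℚ) := mul_nonneg (by linarith) (by positivity)
      linarith
    simp only [raneyCoeff, Nat.add_sub_cancel]
    push_cast at h2 ⊢
    rw [div_mul_eq_mul_div, div_mul_eq_mul_div, div_eq_div_iff h1 h2]
    linear_combination -hc

/-- The Raney series in the variable `t x ^ s`. -/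
noncomputable def raneySubst (s v : ℕ) : MvPowerSeries (Fin 2) ℚ :=
  (raneySeries s v).subst (tVar * xVar ^ s)

theorem raneySubst_succ {s : ℕ} (hs : 0 < s) (v : ℕ) :
    raneySubst s (v + 1) = raneySubst s v + tVar * xVar ^ s * raneySubst s (v + s) := by
  have h := hasSubst_tVar_mul_xVar_pow s
  rw [raneySubst, raneySeries_succ hs, PowerSeries.subst_add h, PowerSeries.subst_mul h,
    PowerSeries.subst_X h]
  rfl

theorem raneySubst_zero (s : ℕ) : raneySubst s 0 = 1 := by
  have h := hasSubst_tVar_mul_xVar_pow s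
  rw [raneySubst, raneySeries_zero, ← PowerSeries.coe_substAlgHom h, map_one]

theorem raneySubst_one {s : ℕ} (hs : 0 < s) : raneySubst s 1 = fussCatalanSubst s := by
  rw [raneySubst, raneySeries_one hs, fussCatalanSubst]

theorem raneySubst_eq_one_add_sum {s : ℕ} (hs : 0 < s) (v : ℕ) :
    raneySubst s v = 1 + tVar * xVar ^ s * ∑ u ∈ Finset.range v, raneySubst s (u + s) := by
  induction v with
  | zero => simp [raneySubst_zero]
  | succ v ih => rw [raneySubst_succ hs, Finset.sum_range_succ, ih]; ring

theorem fussCatalanSubst_sub_one {s : ℕ} (hs : 0 < s) :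
    fussCatalanSubst s - 1 = tVar * xVar ^ s * raneySubst s s := by
  rw [← raneySubst_one hs, raneySubst_eq_one_add_sum hs 1]
  simp

/-! ### The linear system for the walk series -/

/-- A family of series all of whose members are `t` times combinations of members vanishes. -/
theorem eq_zero_of_eq_tVar_mul {E : ℕ → MvPowerSeries (Fin 2) ℚ}
    (h : ∀ k, (∀ u, tVar ^ k ∣ E u) → ∀ u, tVar ^ (k + 1) ∣ E u) (u : ℕ) : E u = 0 := by
  have hall : ∀ k u, tVar ^ k ∣ E u := by
    intro k
    induction k with
    | zero => simp
    | succ k ih => exact h k ih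
  ext d
  -- Divisibility by one power of `t` beyond the exponent in `d` kills this coefficient.
  exact MvPowerSeries.X_pow_dvd_iff.mp (hall (d 0 + 1) u) d (Nat.lt_succ_self _)

/-- The unique solution of the linear system satisfied by the generating series of walks. -/
theorem linear_system_solution {s : ℕ} (hs : 0 < s) (X : MvPowerSeries (Fin 2) ℚ)
    (F : ℕ → MvPowerSeries (Fin 2) ℚ)
    (hF : ∀ u, F u = 1 + tVar * xVar ^ s * ∑ v ∈ Finset.range (u + s), F v +
      tVar * xVar ^ s * X * F 0)
    {V : MvPowerSeries (Fin 2) ℚ} (hV : (1 - X * (fussCatalanSubst s - 1)) * V = 1) (u : ℕ) :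
    F u = V * raneySubst s (u + s) := by
  rw [← sub_eq_zero]
  refine eq_zero_of_eq_tVar_mul (E := fun u => F u - V * raneySubst s (u + s)) ?_ u
  intro k hk u
  -- The inhomogeneous terms cancel because `V = 1 + X (B - 1) V` and `B - 1 = t x^s B^s`; the
  -- errors thus satisfy the homogeneous system, which gains a factor `t`.
  have key : F u - V * raneySubst s (u + s) = tVar * (xVar ^ s *
      (∑ v ∈ Finset.range (u + s), (F v - V * raneySubst s (v + s)) +
        X * (F 0 - V * raneySubst s (0 + s)))) := by
    rw [Finset.sum_sub_distrib, ← Finset.mul_sum]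
    have h1 := raneySubst_eq_one_add_sum hs (u + s)
    have h2 := fussCatalanSubst_sub_one hs
    rw [h2] at hV
    rw [zero_add]
    linear_combination hF u - V * h1 - hV
  rw [key, pow_succ']
  exact mul_dvd_mul_left _ (Dvd.dvd.mul_left (dvd_add (Finset.dvd_sum fun v _ => hk v)
    (Dvd.dvd.mul_left (hk 0) _)) _)

theorem isUnit_one_sub_mul_fussCatalanSubst {s : ℕ} (hs : 0 < s)
    (X : MvPowerSeries (Fin 2) ℚ) : IsUnit (1 - X * (fussCatalanSubst s - 1)) := by
  rw [MvPowerSeries.isUnit_iff_constantCoeff, fussCatalanSubst_sub_one hs]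
  simp [tVar]

/-! ### Walks and their generating series -/

/-- The possible steps of a walk: the first entry is the length that remains, the second one the
slack. A step of length `s` increases the slack by less than `s`; a longer step resets it. -/
def walkSteps (s m : ℕ) (a : ℕ × ℕ) : Finset (ℕ × ℕ) :=
  ((Finset.range (a.1 + 1)) ×ˢ (Finset.range (a.2 + s))).filter fun b =>
    b.1 + s = a.1 ∨ (b.1 + s < a.1 ∧ a.1 < b.1 + m ∧ b.2 = 0)

/-- The number of walks with `k` steps that use up the remaining length. -/
def walkCount (s m : ℕ) : ℕ → ℕ × ℕ → ℕ
  | 0, a => if a.1 = 0 then 1 else 0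
  | k + 1, a => ∑ b ∈ walkSteps s m a, walkCount s m k b

/-- A walk with `k` steps that starts at `a` and uses up the remaining length. -/
structure IsWalk (s m k : ℕ) (a : ℕ × ℕ) (f : Fin (k + 1) → ℕ × ℕ) : Prop where
  start : f 0 = a
  finish : (f (Fin.last k)).1 = 0
  step : ∀ j : Fin k, f j.succ ∈ walkSteps s m (f j.castSucc)

/-- A walk is a first step followed by a walk. -/
def walkSuccEquiv (s m k : ℕ) (a : ℕ × ℕ) :
    {f // IsWalk s m (k + 1) a f} ≃
      Σ b : {b // b ∈ walkSteps s m a}, {f // IsWalk s m k b f} where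
  toFun f := ⟨⟨f.1 1, by have := f.2.step 0; simpa [f.2.start] using this⟩,
    ⟨Fin.tail f.1, ⟨rfl, f.2.finish, fun j => f.2.step j.succ⟩⟩⟩
  invFun g := ⟨Fin.cons a g.2.1, ⟨rfl, by
      rw [← Fin.succ_last, Fin.cons_succ]; exact g.2.2.finish, fun j => by
      refine Fin.cases ?_ (fun j => ?_) j
      · simp [g.2.2.start]
      · simpa using g.2.2.step j⟩⟩
  left_inv f := by
    apply Subtype.ext
    have := Fin.cons_self_tail f.1
    rwa [f.2.start] at this
  right_inv g := by
    obtain ⟨⟨b, hb⟩, ⟨f, hf⟩⟩ := g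
    obtain rfl := hf.start
    rfl

/-- Finiteness is carried through the induction because `Nat.card` of a sigma type is a sum only for
finite fibres. -/
theorem finite_and_card_isWalk (s m k : ℕ) (a : ℕ × ℕ) :
    Finite {f // IsWalk s m k a f} ∧ Nat.card {f // IsWalk s m k a f} = walkCount s m k a := by
  induction k generalizing a with
  | zero =>
    have hsub : Subsingleton {f // IsWalk s m 0 a f} := by
      refine ⟨fun f g => Subtype.ext (funext fun j => ?_)⟩
      rw [Subsingleton.elim (α := Fin 1) j 0, f.2.start, g.2.start]
    refine ⟨inferInstance, ?_⟩
    by_cases h : a.1 = 0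
    · have : Nonempty {f // IsWalk s m 0 a f} :=
        ⟨⟨fun _ => a, ⟨rfl, h, fun j => j.elim0⟩⟩⟩
      rw [walkCount, if_pos h, Nat.card_eq_one_iff_unique]
      exact ⟨hsub, this⟩
    · have : IsEmpty {f // IsWalk s m 0 a f} := by
        refine ⟨fun f => h ?_⟩
        rw [← f.2.start]
        exact f.2.finish
      simp [walkCount, h]
  | succ k ih =>
    have hfin : ∀ b : {b // b ∈ walkSteps s m a}, Finite {f // IsWalk s m k b f} :=
      fun b => (ih b).1
    refine ⟨Finite.of_equiv _ (walkSuccEquiv s m k a).symm, ?_⟩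
    rw [Nat.card_congr (walkSuccEquiv s m k a), Nat.card_sigma, walkCount,
      ← Finset.sum_coe_sort (walkSteps s m a)]
    exact Finset.sum_congr rfl fun b _ => (ih b).2

theorem sum_walkSteps {s m : ℕ} (hs : 0 < s) (L u : ℕ) (g : ℕ × ℕ → ℚ) :
    ∑ b ∈ walkSteps s m (L, u), g b =
      (if s ≤ L then ∑ v ∈ Finset.range (u + s), g (L - s, v) else 0) +
        ∑ j ∈ Finset.Icc 1 (m - s - 1), if s + j ≤ L then g (L - (s + j), 0) else 0 := by
  have h1 : (if s ≤ L then ∑ v ∈ Finset.range (u + s), g (L - s, v) else 0) =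
      ∑ b ∈ (walkSteps s m (L, u)).filter (fun b => b.1 + s = L), g b := by
    split_ifs with h
    · refine Finset.sum_bij (fun v _ => (L - s, v)) ?_ ?_ ?_ ?_
      · intro v hv
        simp only [walkSteps, Finset.mem_filter, Finset.mem_product, Finset.mem_range] at hv ⊢
        omega
      · intro v _ w _ h
        simpa using h
      · rintro ⟨a, v⟩ hb
        simp only [walkSteps, Finset.mem_filter, Finset.mem_product, Finset.mem_range] at hb
        exact ⟨v, Finset.mem_range.mpr hb.1.1.2, by rw [Prod.mk.injEq]; omega⟩
      · intro v _
        rfl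
    · symm
      apply Finset.sum_eq_zero
      intro b hb
      rw [Finset.mem_filter] at hb
      omega
  have h2 : (∑ j ∈ Finset.Icc 1 (m - s - 1), if s + j ≤ L then g (L - (s + j), 0) else 0) =
      ∑ b ∈ (walkSteps s m (L, u)).filter (fun b => ¬ b.1 + s = L), g b := by
    rw [← Finset.sum_filter]
    refine Finset.sum_bij (fun j _ => (L - (s + j), 0)) ?_ ?_ ?_ ?_
    · intro v hv
      simp only [walkSteps, Finset.mem_filter, Finset.mem_product, Finset.mem_range,
        Finset.mem_Icc, and_true] at hv ⊢
      omega
    · intro v hv w hw h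
      simp only [Finset.mem_filter, Finset.mem_Icc, Prod.mk.injEq] at hv hw h
      omega
    · rintro ⟨a, v⟩ hb
      simp only [walkSteps, Finset.mem_filter, Finset.mem_product, Finset.mem_range] at hb
      refine ⟨L - a - s, ?_, ?_⟩
      · simp only [Finset.mem_filter, Finset.mem_Icc]
        omega
      · rw [Prod.mk.injEq]
        omega
    · intro v _
      rfl
  rw [h1, h2, Finset.sum_filter_add_sum_filter_not]

/-- The generating series of the walks with initial slack `u`. -/
noncomputable def walkSeries (s m u : ℕ) : MvPowerSeries (Fin 2) ℚ :=
  fun d => (walkCount s m (d 0) (d 1, u) : ℚ)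

theorem coeff_walkSeries (s m u : ℕ) (d : Fin 2 →₀ ℕ) :
    MvPowerSeries.coeff d (walkSeries s m u) = walkCount s m (d 0) (d 1, u) := rfl

/-- The exponent of `t ^ k x ^ n`. -/
noncomputable def bidegree (k n : ℕ) : Fin 2 →₀ ℕ := Finsupp.single 0 k + Finsupp.single 1 n

@[simp] theorem bidegree_zero (k n : ℕ) : bidegree k n 0 = k := by simp [bidegree]

@[simp] theorem bidegree_one (k n : ℕ) : bidegree k n 1 = n := by simp [bidegree]

theorem bidegree_eta (d : Fin 2 →₀ ℕ) : bidegree (d 0) (d 1) = d := by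
  ext i
  fin_cases i <;> simp

theorem bidegree_sub (k n k' n' : ℕ) :
    bidegree k n - bidegree k' n' = bidegree (k - k') (n - n') := by
  ext i
  fin_cases i <;> simp

theorem bidegree_le {k n k' n' : ℕ} : bidegree k n ≤ bidegree k' n' ↔ k ≤ k' ∧ n ≤ n' := by
  rw [Finsupp.le_def, Fin.forall_fin_two]
  simp

theorem tVar_mul_xVar_pow (j : ℕ) :
    tVar * xVar ^ j = MvPowerSeries.monomial (bidegree 1 j) (1 : ℚ) := by
  rw [tVar, xVar, MvPowerSeries.X, MvPowerSeries.X_pow_eq, MvPowerSeries.monomial_mul_monomial,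
    one_mul]
  rfl

theorem coeff_tVar_mul_xVar_pow_mul (j k n : ℕ) (f : MvPowerSeries (Fin 2) ℚ) :
    MvPowerSeries.coeff (bidegree k n) (tVar * xVar ^ j * f) =
      if 1 ≤ k ∧ j ≤ n then MvPowerSeries.coeff (bidegree (k - 1) (n - j)) f else 0 := by
  classical
  rw [tVar_mul_xVar_pow, MvPowerSeries.coeff_monomial_mul, bidegree_sub]
  simp [bidegree_le]

/-- First-step decomposition: the `1` is the empty walk, the middle term a step of length `s`, the
last term a longer step, after which the slack is `0`. -/
theorem walkSeries_eq {s m : ℕ} (hs : 0 < s) (u : ℕ) :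
    walkSeries s m u = 1 + tVar * xVar ^ s * ∑ v ∈ Finset.range (u + s), walkSeries s m v +
      tVar * xVar ^ s * (∑ j ∈ Finset.Icc 1 (m - s - 1), xVar ^ j) * walkSeries s m 0 := by
  have hX : tVar * xVar ^ s * (∑ j ∈ Finset.Icc 1 (m - s - 1), xVar ^ j) * walkSeries s m 0 =
      ∑ j ∈ Finset.Icc 1 (m - s - 1), tVar * xVar ^ (s + j) * walkSeries s m 0 := by
    rw [Finset.mul_sum, Finset.sum_mul]
    exact Finset.sum_congr rfl fun j _ => by rw [pow_add]; ring
  rw [hX]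
  ext d
  rw [← bidegree_eta d]
  generalize d 0 = k
  generalize d 1 = n
  simp only [map_add, map_sum, coeff_tVar_mul_xVar_pow_mul, coeff_walkSeries, bidegree_zero,
    bidegree_one]
  cases k with
  | zero =>
    classical
    have : bidegree 0 n = 0 ↔ n = 0 := by
      constructor
      · intro h
        simpa using DFunLike.congr_fun h 1
      · rintro rfl
        simp [bidegree]
    simp [walkCount, MvPowerSeries.coeff_one, this]
  | succ k =>
    classical
    have : bidegree (k + 1) n ≠ 0 := by
      intro h
      simpa using DFunLike.congr_fun h 0
    simp only [walkCount, Nat.cast_sum, sum_walkSteps hs, MvPowerSeries.coeff_one, this]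
    simp

/-! ### Permutations that increase off a set of positions -/

/-- The value of a permutation at a number, with junk value outside the domain. -/
def permVal {n : ℕ} (π : Equiv.Perm (Fin n)) (x : ℕ) : ℕ :=
  if h : x < n then π ⟨x, h⟩ else x

theorem permVal_of_lt {n : ℕ} (π : Equiv.Perm (Fin n)) {x : ℕ} (h : x < n) :
    permVal π x = π ⟨x, h⟩ := dif_pos h

theorem permVal_coe {n : ℕ} (π : Equiv.Perm (Fin n)) (x : Fin n) : permVal π x = π x :=
  permVal_of_lt π x.2

/-- A permutation is determined by its values at some positions if it is increasing at the others. -/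
theorem perm_eq_of_strictMonoOn_compl {n k : ℕ} {c : Fin k → Fin n} {π ρ : Equiv.Perm (Fin n)}
    (h : ∀ j, π (c j) = ρ (c j)) (hπ : StrictMonoOn π (Set.range c)ᶜ)
    (hρ : StrictMonoOn ρ (Set.range c)ᶜ) : π = ρ := by
  have himg : π '' Set.range c = ρ '' Set.range c := by
    rw [← Set.range_comp, ← Set.range_comp]
    exact congrArg Set.range (funext h)
  have hr : Set.range ((Set.range c)ᶜ.domRestrict π) = Set.range ((Set.range c)ᶜ.domRestrict ρ) := by
    rw [Set.range_domRestrict, Set.range_domRestrict, Set.image_compl_eq π.bijective,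
      Set.image_compl_eq ρ.bijective, himg]
  have heq := (StrictMono.range_inj (strictMono_domRestrict.mpr hπ)
    (strictMono_domRestrict.mpr hρ)).mp hr
  ext x
  by_cases hx : x ∈ Set.range c
  · obtain ⟨j, rfl⟩ := hx
    rw [h]
  · exact congrArg Fin.val (congrFun heq ⟨x, hx⟩)

/-- Prescribed distinct values at some positions extend to a permutation that is increasing at the
others. -/
theorem exists_perm_strictMonoOn_compl {n k : ℕ} {c w : Fin k → Fin n}
    (hc : Function.Injective c) (hw : Function.Injective w) :
    ∃ π : Equiv.Perm (Fin n), (∀ j, π (c j) = w j) ∧ StrictMonoOn π (Set.range c)ᶜ := by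
  classical
  have hcard : ∀ g : Fin k → Fin n, Function.Injective g →
      Fintype.card {x // x ∉ Set.range g} = n - k := by
    intro g hg
    rw [Fintype.card_subtype_compl, Fintype.card_fin]
    congr 1
    exact (Fintype.card_congr (Equiv.ofInjective g hg)).symm.trans (Fintype.card_fin k)
  let e : {x // x ∉ Set.range c} ≃o {x // x ∉ Set.range w} :=
    (Fintype.orderIsoFinOfCardEq _ (hcard c hc)).symm.trans
      (Fintype.orderIsoFinOfCardEq _ (hcard w hw))
  let e₀ : {x // x ∈ Set.range c} ≃ {x // x ∈ Set.range w} :=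
    (Equiv.ofInjective c hc).symm.trans (Equiv.ofInjective w hw)
  refine ⟨Equiv.subtypeCongr e₀ e.toEquiv, fun j => ?_, fun x hx y hy hxy => ?_⟩
  · have : (Equiv.ofInjective c hc).symm ⟨c j, Set.mem_range_self j⟩ = j :=
      Equiv.ofInjective_symm_apply hc j
    simp [Equiv.subtypeCongr, Equiv.sumCompl_symm_apply_of_pos, e₀, this]
  · have hval : ∀ z (hz : z ∉ Set.range c),
        Equiv.subtypeCongr e₀ e.toEquiv z = (e ⟨z, hz⟩ : Fin n) := fun z hz => by
      have : (Equiv.sumCompl (· ∈ Set.range c)).symm z = Sum.inr ⟨z, hz⟩ :=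
        Equiv.sumCompl_symm_apply_of_neg hz
      simp only [Equiv.subtypeCongr, Equiv.trans_apply, this]
      rfl
    rw [hval x hx, hval y hy]
    exact e.strictMono hxy

/-- Comparison of the entries of a shuffle of two increasing sequences. -/
theorem shuffle_lt_iff {n k : ℕ} {c : Fin k → Fin n} {π : Equiv.Perm (Fin n)}
    (hc : Function.Injective c) (hπc : StrictMono (π ∘ c)) (hπ : StrictMonoOn π (Set.range c)ᶜ)
    {x : Fin n} (hx : x ∉ Set.range c) (j : Fin k) :
    π x < π (c j) ↔
      (x : ℕ) + j < π (c j) + (Finset.univ.filter fun i : Fin k => c i < x).card := by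
  classical
  -- Among the entries below `π (c j)`, exactly `j` sit at positions of `c`; the others are counted
  -- here. Next, `hB` finds the rank of `x` among the positions off `c`. Since `π` increases there,
  -- comparing the two counts decides the inequality.
  have hA : ((Finset.univ.filter fun z => π z < π (c j) ∧ z ∉ Set.range c)).card + j =
      π (c j) := by
    have h1 : (Finset.univ.filter fun z => π z < π (c j)).card = π (c j) := by
      rw [← Fin.card_Iio (π (c j)), ← Finset.card_map π.toEmbedding]
      congr 1
      ext y
      simp
    have h2 : (Finset.univ.filter fun z => π z < π (c j) ∧ ¬ z ∉ Set.range c).card = j := by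
      rw [← Fin.card_Iio j, ← Finset.card_image_of_injective _ hc]
      congr 1
      ext y
      simp only [Finset.mem_filter, Finset.mem_univ, true_and, not_not, Finset.mem_image,
        Finset.mem_Iio]
      constructor
      · rintro ⟨h, i, rfl⟩
        exact ⟨i, hπc.lt_iff_lt.mp h, rfl⟩
      · rintro ⟨i, hi, rfl⟩
        exact ⟨hπc hi, i, rfl⟩
    have h3 := Finset.card_filter_add_card_filter_not
      (s := Finset.univ.filter fun z => π z < π (c j)) (fun z => z ∉ Set.range c)
    rw [Finset.filter_filter, Finset.filter_filter, h1, h2] at h3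
    exact h3
  have hB : ((Finset.univ.filter fun z => z < x ∧ z ∉ Set.range c)).card +
      (Finset.univ.filter fun i : Fin k => c i < x).card = x := by
    have h1 : (Finset.univ.filter fun z => z < x).card = x := by
      rw [← Fin.card_Iio x]
      congr 1
      ext y
      simp
    have h2 : (Finset.univ.filter fun z => z < x ∧ ¬ z ∉ Set.range c).card =
        (Finset.univ.filter fun i : Fin k => c i < x).card := by
      rw [← Finset.card_image_of_injective _ hc]
      congr 1
      ext y
      simp only [Finset.mem_filter, Finset.mem_univ, true_and, not_not, Finset.mem_image]
      constructor
      · rintro ⟨h, i, rfl⟩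
        exact ⟨i, h, rfl⟩
      · rintro ⟨i, hi, rfl⟩
        exact ⟨hi, i, rfl⟩
    have h3 := Finset.card_filter_add_card_filter_not
      (s := Finset.univ.filter fun z => z < x) (fun z => z ∉ Set.range c)
    rw [Finset.filter_filter, Finset.filter_filter, h1, h2] at h3
    exact h3
  constructor
  · intro h
    have : ((Finset.univ.filter fun z => z < x ∧ z ∉ Set.range c)).card <
        ((Finset.univ.filter fun z => π z < π (c j) ∧ z ∉ Set.range c)).card := by
      apply Finset.card_lt_card
      refine Finset.ssubset_iff_subset_ne.mpr ⟨fun z hz => ?_, fun heq => ?_⟩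
      · simp only [Finset.mem_filter, Finset.mem_univ, true_and] at hz ⊢
        exact ⟨(hπ hz.2 hx hz.1).trans h, hz.2⟩
      · have := Finset.ext_iff.mp heq x
        simp [h] at this
        simp [this] at hx
    omega
  · intro h
    by_contra hlt
    have hlt' : π (c j) ≤ π x := not_lt.mp hlt
    have : ((Finset.univ.filter fun z => π z < π (c j) ∧ z ∉ Set.range c)).card ≤
        ((Finset.univ.filter fun z => z < x ∧ z ∉ Set.range c)).card := by
      apply Finset.card_le_card
      intro z hz
      simp only [Finset.mem_filter, Finset.mem_univ, true_and] at hz ⊢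
      exact ⟨(hπ.lt_iff_lt hz.2 hx).mp (hz.1.trans_le hlt'), hz.2⟩
    omega

theorem permVal_ne {n : ℕ} (π : Equiv.Perm (Fin n)) {x y : ℕ} (hx : x < n) (hy : y < n)
    (hxy : x ≠ y) : permVal π x ≠ permVal π y := by
  rw [permVal_of_lt π hx, permVal_of_lt π hy]
  simpa [← Fin.ext_iff] using hxy

/-! ### Occurrences as order relations -/

/-- A pattern occurs if and only if the entries are in the prescribed relative order. -/
theorem occursAt_iff {m n : ℕ} (σ : Equiv.Perm (Fin m)) (π : Equiv.Perm (Fin n)) (p : ℕ) :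
    OccursAt σ π p ↔
      p + m ≤ n ∧ ∀ a b : Fin m, σ a < σ b → permVal π (p + a) < permVal π (p + b) := by
  constructor
  · rintro ⟨h, hred⟩
    refine ⟨h, fun a b hab => ?_⟩
    rw [permVal_of_lt π (by omega), permVal_of_lt π (by omega)]
    by_contra hlt
    rw [Fin.lt_def, ← hred a, ← hred b] at hab
    refine absurd hab (not_lt.mpr (Finset.card_le_card fun x hx => ?_))
    simp only [Finset.mem_filter, Finset.mem_univ, true_and] at hx ⊢
    exact hx.trans_le (not_lt.mp hlt)
  · rintro ⟨h, hord⟩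
    refine ⟨h, fun a => ?_⟩
    have hval : ∀ b : Fin m, (π ⟨p + b, by omega⟩ : ℕ) = permVal π (p + b) := fun b =>
      (permVal_of_lt π _).symm
    rw [reduction, ← Fin.card_Iio (σ a), ← Finset.card_map σ.toEmbedding]
    congr 1
    ext y
    simp only [Finset.mem_map_equiv, Finset.mem_filter, Finset.mem_univ, true_and,
      Finset.mem_Iio, hval]
    have hy := σ.apply_symm_apply y
    constructor
    · intro hlt
      rw [← hy]
      rcases lt_trichotomy (σ (σ.symm y)) (σ a) with h1 | h1 | h1
      · exact h1
      · rw [σ.injective h1] at hlt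
        exact absurd hlt (lt_irrefl _)
      · exact absurd hlt (hord _ _ h1).not_gt
    · intro hlt
      exact hord _ _ (hy.symm ▸ hlt)

/-- The order relations between the entries of an occurrence of `1 3 4 ⋯ (s+1) 2 (s+2) ⋯ m`. -/
structure PatternChain (s m : ℕ) (v : ℕ → ℕ) (p : ℕ) : Prop where
  first_lt : v p < v (p + s)
  lt_second : v (p + s) < v (p + 1)
  increasing : ∀ a b, 1 ≤ a → a < b → b < m → a ≠ s → b ≠ s → v (p + a) < v (p + b)

theorem PatternChain.lt {s m p x y : ℕ} {v : ℕ → ℕ} (h : PatternChain s m v p) (hs : 2 ≤ s)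
    (hpx : p ≤ x) (hxy : x < y) (hym : y < p + m) (hx : x ≠ p + s) (hy : y ≠ p + s) :
    v x < v y := by
  obtain ⟨a, rfl⟩ := Nat.exists_eq_add_of_le hpx
  obtain ⟨b, rfl⟩ := Nat.exists_eq_add_of_le (hpx.trans hxy.le)
  rcases Nat.eq_zero_or_pos a with rfl | ha
  · have h1 := h.first_lt.trans h.lt_second
    rcases Nat.lt_or_ge 1 b with hb | hb
    · exact h1.trans (h.increasing 1 b le_rfl hb (by omega) (by omega) (by omega))
    · have : b = 1 := by omega
      rw [this]
      exact h1
  · exact h.increasing a b ha (by omega) (by omega) (by omega) (by omega)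

theorem pattern1324_val {s m : ℕ} (h : s + 2 ≤ m) (a : Fin m) :
    (pattern1324 s m h a : ℕ) = if (a : ℕ) = 0 then (0 : ℕ) else
      if (a : ℕ) < s then (a : ℕ) + 1 else if (a : ℕ) = s then 1 else (a : ℕ) := by
  simp only [pattern1324, Equiv.ofBijective_apply]
  split_ifs <;> rfl

theorem occursAt_pattern1324_iff {s m n : ℕ} (hs : 2 ≤ s) (h : s + 2 ≤ m)
    (π : Equiv.Perm (Fin n)) (p : ℕ) :
    OccursAt (pattern1324 s m h) π p ↔ p + m ≤ n ∧ PatternChain s m (permVal π) p := by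
  rw [occursAt_iff]
  refine and_congr_right fun _ => ⟨fun H => ?_, fun H a b hab => ?_⟩
  · refine ⟨?_, ?_, fun a b h1 h2 h3 h4 h5 => ?_⟩
    · refine H ⟨0, by omega⟩ ⟨s, by omega⟩ ?_
      rw [Fin.lt_def, pattern1324_val, pattern1324_val]
      dsimp only
      rw [if_pos rfl, if_neg (by omega), if_neg (lt_irrefl s), if_pos rfl]
      exact Nat.zero_lt_one
    · refine H ⟨s, by omega⟩ ⟨1, by omega⟩ ?_
      rw [Fin.lt_def, pattern1324_val, pattern1324_val]
      dsimp only
      rw [if_neg (by omega), if_neg (lt_irrefl s), if_pos rfl, if_neg one_ne_zero,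
        if_pos (by omega)]
      exact Nat.lt_succ_self 1
    · refine H ⟨a, by omega⟩ ⟨b, by omega⟩ ?_
      rw [Fin.lt_def, pattern1324_val, pattern1324_val]
      dsimp only
      split_ifs <;> omega
  · rw [Fin.lt_def, pattern1324_val, pattern1324_val] at hab
    obtain ⟨a, ha⟩ := a
    obtain ⟨b, hb⟩ := b
    dsimp only at hab ⊢
    by_cases has : a = s
    · subst has
      have hb2 : 1 ≤ b ∧ b ≠ a := by split_ifs at hab <;> omega
      rcases Nat.lt_or_ge 1 b with hb1 | hb1
      · exact H.lt_second.trans (H.increasing 1 b le_rfl hb1 hb (by omega) hb2.2)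
      · have : b = 1 := by omega
        rw [this]
        exact H.lt_second
    · by_cases hbs : b = s
      · subst hbs
        have : a = 0 := by split_ifs at hab <;> omega
        rw [this]
        exact H.first_lt
      · exact H.lt hs (by omega) (by split_ifs at hab <;> omega) (by omega) (by omega) (by omega)

/-! ### Spaced windows and the exceptional positions `p j + s` -/

/-- Starting positions of windows of length `m` that cover `0, …, n - 1`, where consecutive ones
overlap and are at least `s` apart. -/
structure IsSpaced (s m n : ℕ) {k : ℕ} (p : Fin (k + 1) → ℕ) : Prop where
  first : p 0 = 0
  last : p (Fin.last k) + m = n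
  add_le_succ : ∀ j : Fin k, p j.castSucc + s ≤ p j.succ
  succ_lt_add : ∀ j : Fin k, p j.succ < p j.castSucc + m

namespace IsSpaced

variable {s m n k : ℕ} {p : Fin (k + 1) → ℕ}

theorem strictMono (h : IsSpaced s m n p) (hs : 2 ≤ s) : StrictMono p :=
  Fin.strictMono_iff_lt_succ.mpr fun j => by have := h.add_le_succ j; omega

theorem add_le (h : IsSpaced s m n p) (hs : 2 ≤ s) {a b : Fin (k + 1)} (hab : a < b) :
    p a + s ≤ p b := by
  obtain ⟨j, rfl⟩ := Fin.eq_castSucc_of_ne_last (Fin.ne_last_of_lt hab)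
  exact (h.add_le_succ j).trans ((h.strictMono hs).monotone (Fin.castSucc_lt_iff_succ_le.mp hab))

theorem add_le_length (h : IsSpaced s m n p) (hs : 2 ≤ s) (j : Fin (k + 1)) : p j + m ≤ n := by
  have := (h.strictMono hs).monotone (Fin.le_last j)
  have := h.last
  omega

theorem exists_window (h : IsSpaced s m n p) {x : ℕ} (hx : x + 1 < n) :
    ∃ j, p j ≤ x ∧ x + 1 < p j + m := by
  by_contra! hno
  have hall : ∀ j, p j ≤ x := by
    intro j
    induction j using Fin.induction with
    | zero => rw [h.first]; exact Nat.zero_le _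
    | succ j ih =>
      have := hno _ ih
      have := h.succ_lt_add j
      omega
  have := hno _ (hall (Fin.last k))
  have := h.last
  omega

theorem add_ne_succ (h : IsSpaced s m n p) (hs : 2 ≤ s) (i j : Fin (k + 1)) :
    p i + s ≠ p j + 1 := by
  rcases lt_or_ge i j with hij | hij
  · have := h.add_le hs hij
    omega
  · have := (h.strictMono hs).monotone hij
    omega

theorem add_ne_add_succ (h : IsSpaced s m n p) (hs : 2 ≤ s) (i j : Fin (k + 1)) :
    p i + s ≠ p j + s + 1 := by
  rcases lt_trichotomy i j with hij | rfl | hij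
  · have := h.add_le hs hij
    omega
  · omega
  · have := h.add_le hs hij
    omega

end IsSpaced

/-- The function `v` is increasing outside the positions `p j + s`. -/
def IncreasingOff (s n : ℕ) {k : ℕ} (p : Fin (k + 1) → ℕ) (v : ℕ → ℕ) : Prop :=
  ∀ x y, x < y → y < n → (∀ j, x ≠ p j + s) → (∀ j, y ≠ p j + s) → v x < v y

/-- Neighbouring ordinary positions share a window, where the pattern orders them; chaining these
comparisons gives the rest. -/
theorem IsSpaced.increasingOff {s m n k : ℕ} {p : Fin (k + 1) → ℕ} (h : IsSpaced s m n p)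
    (hs : 2 ≤ s) (hsm : s + 2 ≤ m) {v : ℕ → ℕ} (hv : ∀ j, PatternChain s m v (p j)) :
    IncreasingOff s n p v := by
  have key : ∀ d x y, y ≤ x + d → x < y → y < n → (∀ j, x ≠ p j + s) → (∀ j, y ≠ p j + s) →
      v x < v y := by
    intro d
    induction d with
    | zero => intro x y h1 h2; omega
    | succ d ih =>
      intro x y hyd hxy hyn hx hy
      obtain ⟨j, hj1, hj2⟩ := h.exists_window (x := x) (by omega)
      by_cases hx1 : ∀ i, x + 1 ≠ p i + s
      · have h1 := (hv j).lt hs hj1 (Nat.lt_succ_self x) hj2 (hx j) (hx1 j)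
        rcases Nat.lt_or_ge (x + 1) y with h2 | h2
        · exact h1.trans (ih (x + 1) y (by omega) h2 hyn hx1 hy)
        · have : y = x + 1 := by omega
          rwa [this]
      -- Here `x + 1 = p i + s` is exceptional. Both `x` and `x + 2` lie in window `i` as `s + 2 ≤
      -- m`, and exceptional positions are never adjacent, so the chain can jump over `x + 1`.
      · push Not at hx1
        obtain ⟨i, hi⟩ := hx1
        have hx2 : ∀ j, x + 2 ≠ p j + s := fun j hj => h.add_ne_add_succ hs j i (by omega)
        have h1 := (hv i).lt hs (x := x) (y := x + 2) (by omega) (by omega) (by omega) (hx i)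
          (hx2 i)
        have := hy i
        rcases Nat.lt_or_ge (x + 2) y with h2 | h2
        · exact h1.trans (ih (x + 2) y (by omega) h2 hyn hx2 hy)
        · have : y = x + 2 := by omega
          rwa [this]
  exact fun x y => key y x y (by omega)

/-- Exactly `j` exceptional positions precede `x`, so the two corrections in `shuffle_lt_iff`
cancel. -/
theorem IsSpaced.permVal_lt_iff {s m n k : ℕ} {p : Fin (k + 1) → ℕ} (h : IsSpaced s m n p)
    (hs : 2 ≤ s) (hsm : s + 2 ≤ m) {π : Equiv.Perm (Fin n)}
    (hw : StrictMono fun j => permVal π (p j + s)) (hoff : IncreasingOff s n p (permVal π))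
    {x : ℕ} (hx : x < n) (hxc : ∀ j, x ≠ p j + s) {j : Fin (k + 1)} (h1 : ∀ i < j, p i + s < x)
    (h2 : x < p j + s) :
    permVal π x < permVal π (p j + s) ↔ x < permVal π (p j + s) := by
  have hcn : ∀ i, p i + s < n := fun i => by have := h.add_le_length hs i; omega
  let c : Fin (k + 1) → Fin n := fun i => ⟨p i + s, hcn i⟩
  have hc : StrictMono c := fun a b hab => by
    have := h.strictMono hs hab
    exact Fin.lt_def.mpr (by dsimp only [c]; omega)
  have hval : ∀ i, (π (c i) : ℕ) = permVal π (p i + s) := fun i => (permVal_of_lt π (hcn i)).symm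
  have hcount : (Finset.univ.filter fun i => c i < (⟨x, hx⟩ : Fin n)).card = j := by
    rw [← Fin.card_Iio j]
    congr 1
    ext i
    simp only [Finset.mem_filter, Finset.mem_univ, true_and, Finset.mem_Iio]
    refine ⟨fun hi => ?_, fun hi => Fin.lt_def.mpr (h1 i hi)⟩
    by_contra hij
    have h3 := (h.strictMono hs).monotone (not_lt.mp hij)
    have h4 : p i + s < x := hi
    omega
  have hmem : ∀ z : Fin n, z ∈ (Set.range c)ᶜ → ∀ i, (z : ℕ) ≠ p i + s := fun z hz i hi =>
    hz ⟨i, Fin.ext hi.symm⟩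
  have key := shuffle_lt_iff (c := c) (π := π) hc.injective
    (fun a b hab => by
      have := hw hab
      simp only [← hval] at this
      exact Fin.lt_def.mpr this)
    (fun y hy z hz hyz => by
      have := hoff y z hyz z.2 (hmem y hy) (hmem z hz)
      rw [permVal_coe, permVal_coe] at this
      exact Fin.lt_def.mpr this)
    (x := ⟨x, hx⟩) (by rintro ⟨i, hi⟩; exact hxc i (Fin.ext_iff.mp hi).symm) j
  rw [hcount, Fin.lt_def, hval] at key
  rw [permVal_of_lt π hx, key]
  exact Nat.add_lt_add_iff_right

/-- The starting positions `p j` of the windows of a cluster, together with the entries `w j` at the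
positions `p j + s`. -/
structure IsShuffle (s m n : ℕ) {k : ℕ} (p w : Fin (k + 1) → ℕ) : Prop
    extends IsSpaced s m n p where
  value_zero : w 0 = 1
  value_lt_succ : ∀ j : Fin k, w j.castSucc < w j.succ
  value_le : ∀ j : Fin k, w j.succ ≤ p j.succ + 1
  gap_or_value : ∀ j : Fin k, p j.succ = p j.castSucc + s ∨ w j.succ = p j.succ + 1

theorem IsSpaced.isShuffle {s m n k : ℕ} {p : Fin (k + 1) → ℕ} (h : IsSpaced s m n p)
    (hs : 2 ≤ s) (hsm : s + 2 ≤ m) {π : Equiv.Perm (Fin n)}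
    (hv : ∀ j, PatternChain s m (permVal π) (p j)) :
    IsShuffle s m n p fun j => permVal π (p j + s) := by
  have hoff := h.increasingOff hs hsm hv
  have hlt : ∀ j : Fin k, permVal π (p j.castSucc + s) < permVal π (p j.succ + s) := by
    intro j
    have h1 := (hv j.succ).first_lt
    have h2 := h.add_le_succ j
    have h3 := h.succ_lt_add j
    -- For a gap of exactly `s`, the displaced letter of one window is the first letter of the next;
    -- otherwise position `p j.succ` is ordinary and serves as a link.
    rcases h2.eq_or_lt with h4 | h4
    · rwa [h4]
    · exact ((hv j.castSucc).lt_second.trans ((hv j.castSucc).lt hs (by omega) (by omega) h3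
        (by omega) (by omega))).trans h1
  have hw : StrictMono fun j => permVal π (p j + s) := Fin.strictMono_iff_lt_succ.mpr hlt
  have hle : ∀ j, permVal π (p j + s) ≤ p j + 1 := by
    intro j
    have := h.add_le_length hs j
    by_contra hlt
    refine absurd ((h.permVal_lt_iff hs hsm hw hoff (x := p j + 1) (j := j) (by omega)
      (fun i hi => h.add_ne_succ hs i j hi.symm) (fun i hi => ?_) (by omega)).mpr (by omega))
      (hv j).lt_second.not_gt
    have := h.add_le hs hi
    omega
  -- If `p j` is ordinary, its entry lies below `w j`, which forces `p j < w j` and meets the upper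
  -- bound.
  have hge : ∀ j, (∀ i, p j ≠ p i + s) → permVal π (p j + s) = p j + 1 := by
    intro j hj
    have h1 := h.add_le_length hs j
    have h2 := (h.permVal_lt_iff hs hsm hw hoff (x := p j) (j := j) (by omega)
      hj (fun i hi => by have := h.add_le hs hi; have := hj i; omega) (by omega)).mp
      (hv j).first_lt
    have := hle j
    omega
  refine ⟨h, ?_, hlt, fun j => hle _, fun j => ?_⟩
  · rw [hge 0 (fun i => by rw [h.first]; omega), h.first]
  · by_cases hj : ∃ i, p j.succ = p i + s
    · left
      obtain ⟨i, hi⟩ := hj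
      have h1 : i < j.succ := (h.strictMono hs).lt_iff_lt.mp (by omega)
      have h2 : i ≤ j.castSucc := Fin.le_castSucc_iff.mpr h1
      have h3 := (h.strictMono hs).monotone h2
      have := h.add_le_succ j
      omega
    · push Not at hj
      exact Or.inr (hge _ hj)

theorem IsShuffle.patternChain {s m n k : ℕ} {p : Fin (k + 1) → ℕ} (hs : 2 ≤ s)
    (hsm : s + 2 ≤ m) (hms : m ≤ 2 * s) {π : Equiv.Perm (Fin n)}
    (h : IsShuffle s m n p fun j => permVal π (p j + s))
    (hoff : IncreasingOff s n p (permVal π)) (j : Fin (k + 1)) :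
    PatternChain s m (permVal π) (p j) := by
  have hsp := h.toIsSpaced
  have hw : StrictMono fun j => permVal π (p j + s) :=
    Fin.strictMono_iff_lt_succ.mpr h.value_lt_succ
  have hjn := hsp.add_le_length hs j
  have hle : permVal π (p j + s) ≤ p j + 1 := by
    induction j using Fin.cases with
    | zero => rw [h.value_zero]; omega
    | succ j => exact h.value_le j
  have hfirst : ∀ i, p j = p i + s → i < j := fun i hi =>
    (hsp.strictMono hs).lt_iff_lt.mp (by omega)
  have h1 : permVal π (p j) < permVal π (p j + s) := by
    by_cases hj : ∃ i, p j = p i + s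
    · obtain ⟨i, hi⟩ := hj
      have : permVal π (p i + s) < permVal π (p j + s) := hw (hfirst i hi)
      rwa [← hi] at this
    · push Not at hj
      refine (hsp.permVal_lt_iff hs hsm hw hoff (x := p j) (j := j) (by omega) hj
        (fun i hi => by have := hsp.add_le hs hi; have := hj i; omega) (by omega)).mpr ?_
      induction j using Fin.cases with
      | zero => rw [h.value_zero, hsp.first]; exact Nat.zero_lt_one
      | succ j =>
        rcases h.gap_or_value j with h2 | h2
        · exact absurd h2 (hj _)
        · rw [h2]; exact Nat.lt_succ_self _
  have h2 : permVal π (p j + s) < permVal π (p j + 1) := by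
    refine lt_of_le_of_ne (not_lt.mp fun hlt => ?_) (permVal_ne π (by omega) (by omega) (by omega))
    have := (hsp.permVal_lt_iff hs hsm hw hoff (x := p j + 1) (j := j) (by omega)
      (fun i hi => hsp.add_ne_succ hs i j hi.symm)
      (fun i hi => by have := hsp.add_le hs hi; omega) (by omega)).mp hlt
    omega
  refine ⟨h1, h2, fun a b ha hab hb has hbs => ?_⟩
  -- This is where `m ≤ 2 * s` enters: later exceptional positions are at least `p j + 2 * s`,
  -- beyond the window, and earlier ones are at most `p j`.
  have hne : ∀ a, 1 ≤ a → a < m → a ≠ s → ∀ i, p j + a ≠ p i + s := by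
    intro a ha ham has i hi
    rcases lt_trichotomy i j with hij | rfl | hij
    · have := hsp.add_le hs hij
      omega
    · omega
    · have := hsp.add_le hs hij
      omega
  exact hoff _ _ (by omega) (by omega) (hne a ha (by omega) has) (hne b (by omega) hb hbs)

theorem isCluster_iff {s m n k : ℕ} (hs : 2 ≤ s) (hsm : s + 2 ≤ m) (hms : m ≤ 2 * s)
    (π : Equiv.Perm (Fin n)) (i : Fin (k + 1) → Fin n) :
    IsCluster (pattern1324 s m hsm) π i ↔
      (IsShuffle s m n (fun j => (i j : ℕ)) fun j => permVal π (i j + s)) ∧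
        IncreasingOff s n (fun j => (i j : ℕ)) (permVal π) := by
  constructor
  · intro h
    have hv : ∀ j, PatternChain s m (permVal π) (i j) := fun j =>
      ((occursAt_pattern1324_iff hs hsm π _).mp (h.occurs j)).2
    have hsp : IsSpaced s m n fun j => (i j : ℕ) := by
      refine ⟨h.first 0 rfl, h.last _ rfl, fun j => ?_, fun j => h.overlap _ _ rfl⟩
      have hlt : (i j.castSucc : ℕ) < i j.succ := h.increasing j.castSucc_lt_succ
      -- With a gap below `s`, the descent from `p j + s - 1` to `p j + s` falls in the next window,
      -- before that window's own displaced letter.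
      by_contra hgap
      have h1 := hv j.castSucc
      have h2 : permVal π (i j.castSucc + s) < permVal π (i j.castSucc + (s - 1)) := by
        rcases Nat.eq_or_lt_of_le hs with rfl | hs'
        · exact h1.lt_second
        · exact h1.lt_second.trans (h1.increasing 1 (s - 1) le_rfl (by omega) (by omega)
            (by omega) (by omega))
      exact absurd h2 ((hv j.succ).lt hs (by omega) (by omega) (by omega) (by omega)
        (by omega)).not_gt
    exact ⟨hsp.isShuffle hs hsm hv, hsp.increasingOff hs hsm hv⟩
  · rintro ⟨h, hoff⟩
    have hsp := h.toIsSpaced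
    refine ⟨k.succ_pos, fun j hj => ?_, hsp.strictMono hs, fun j hj => ?_, fun j => ?_,
      fun j j' hj => ?_⟩
    · obtain rfl : j = 0 := Fin.ext hj
      exact hsp.first
    · obtain rfl : j = Fin.last k := Fin.ext (by simpa using hj)
      exact hsp.last
    · exact (occursAt_pattern1324_iff hs hsm π _).mpr
        ⟨hsp.add_le_length hs j, h.patternChain hs hsm hms hoff j⟩
    · have := hsp.succ_lt_add ⟨j, by omega⟩
      have e1 : (⟨j, by omega⟩ : Fin k).castSucc = j := rfl
      have e2 : (⟨j, by omega⟩ : Fin k).succ = j' := Fin.ext hj.symm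
      rwa [e1, e2] at this

/-! ### Clusters as walks -/

theorem IsShuffle.value_le_all {s m n k : ℕ} {p w : Fin (k + 1) → ℕ} (h : IsShuffle s m n p w)
    (j : Fin (k + 1)) : w j ≤ p j + 1 := by
  induction j using Fin.cases with
  | zero => rw [h.value_zero]; omega
  | succ j => exact h.value_le j

theorem IsShuffle.isWalk {s m n k : ℕ} (hs : 2 ≤ s) {p w : Fin (k + 1) → ℕ}
    (h : IsShuffle s m n p w) :
    IsWalk s m k (n - m, 0) fun j => (n - m - p j, p j + 1 - w j) := by
  refine ⟨?_, ?_, fun j => ?_⟩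
  · simp [h.first, h.value_zero]
  · have := h.last
    dsimp only
    omega
  · have h1 := h.add_le_succ j
    have h2 := h.succ_lt_add j
    have h3 := h.value_lt_succ j
    have h4 := h.value_le_all j.succ
    have h5 := h.value_le_all j.castSucc
    have h6 := h.gap_or_value j
    have h7 := h.add_le_length hs j.succ
    simp only [walkSteps, Finset.mem_filter, Finset.mem_product, Finset.mem_range]
    omega

/-- The slack never exceeds the length already used, so the truncated subtractions that recover `w
j` from a walk are exact. -/
theorem IsWalk.bounds {s m k L : ℕ} {f : Fin (k + 1) → ℕ × ℕ} (h : IsWalk s m k (L, 0) f)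
    (j : Fin (k + 1)) : (f j).1 + (f j).2 ≤ L := by
  induction j using Fin.induction with
  | zero => simp [h.start]
  | succ j ih =>
    have := h.step j
    simp only [walkSteps, Finset.mem_filter, Finset.mem_product, Finset.mem_range] at this
    omega

theorem IsWalk.isShuffle {s m n k : ℕ} (hs : 2 ≤ s) (hsm : s < m) (hmn : m ≤ n)
    {f : Fin (k + 1) → ℕ × ℕ} (h : IsWalk s m k (n - m, 0) f) :
    IsShuffle s m n (fun j => n - m - (f j).1) fun j => n - m - (f j).1 + 1 - (f j).2 := by
  refine ⟨⟨by simp [h.start], by simp [h.finish, hmn], fun j => ?_, fun j => ?_⟩,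
    by simp [h.start], fun j => ?_, fun j => Nat.sub_le _ _, fun j => ?_⟩
  all_goals
    have h1 := h.step j
    have h2 := h.bounds j.castSucc
    have h3 := h.bounds j.succ
    simp only [walkSteps, Finset.mem_filter, Finset.mem_product, Finset.mem_range] at h1
    omega

theorem increasingOff_iff {s n k : ℕ} {p : Fin (k + 1) → ℕ} {c : Fin (k + 1) → Fin n}
    (hc : ∀ j, (c j : ℕ) = p j + s) (π : Equiv.Perm (Fin n)) :
    IncreasingOff s n p (permVal π) ↔ StrictMonoOn π (Set.range c)ᶜ := by
  constructor
  · intro h x hx y hy hxy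
    have := h x y hxy y.2 (fun j hj => hx ⟨j, Fin.ext ((hc j).trans hj.symm)⟩)
      (fun j hj => hy ⟨j, Fin.ext ((hc j).trans hj.symm)⟩)
    rw [permVal_coe, permVal_coe] at this
    exact Fin.lt_def.mpr this
  · intro h x y hxy hyn hx hy
    rw [permVal_of_lt π (hxy.trans hyn), permVal_of_lt π hyn]
    refine Fin.lt_def.mp (h ?_ ?_ (Fin.lt_def.mpr hxy))
    · rintro ⟨j, hj⟩
      exact hx j (by rw [← hc, hj])
    · rintro ⟨j, hj⟩
      exact hy j (by rw [← hc, hj])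

/-- The first window uses `m` letters and has slack `0`; each of the `k` further occurrences is one
step. The values off the exceptional positions carry no choice, which gives injectivity, and any
admissible `w` extends to a permutation, which gives surjectivity. -/
theorem clusterNumber_succ {s m n : ℕ} (hsm : s + 2 ≤ m) (hms : m ≤ 2 * s) (hmn : m ≤ n) (k : ℕ) :
    clusterNumber (pattern1324 s m hsm) n (k + 1) = walkCount s m k (n - m, 0) := by
  have hs : 2 ≤ s := by omega
  rw [← (finite_and_card_isWalk s m k (n - m, 0)).2, clusterNumber]
  refine Nat.card_eq_of_bijective (fun c => ⟨fun j => (n - m - c.1.2 j,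
    c.1.2 j + 1 - permVal c.1.1 (c.1.2 j + s)),
    ((isCluster_iff hs hsm hms _ _).mp c.2).1.isWalk hs⟩) ⟨?_, ?_⟩
  · rintro ⟨⟨π, i⟩, hc⟩ ⟨⟨π', i'⟩, hc'⟩ heq
    obtain ⟨h, hoff⟩ := (isCluster_iff hs hsm hms _ _).mp hc
    obtain ⟨h', hoff'⟩ := (isCluster_iff hs hsm hms _ _).mp hc'
    have hj := fun j => congrFun (congrArg Subtype.val heq) j
    simp only [Prod.mk.injEq] at hj
    dsimp only at hoff hoff' h h'
    obtain rfl : i = i' := by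
      funext j
      have h1 := h.add_le_length hs j
      have h2 := h'.add_le_length hs j
      have := (hj j).1
      exact Fin.ext (by omega)
    have hcn : ∀ j, i j + s < n := fun j => by have := h.add_le_length hs j; omega
    have hπ : π = π' := by
      refine perm_eq_of_strictMonoOn_compl (c := fun j => ⟨i j + s, hcn j⟩) (fun j => ?_)
        ((increasingOff_iff (fun _ => rfl) π).mp hoff)
        ((increasingOff_iff (fun _ => rfl) π').mp hoff')
      have h1 := h.value_le_all j
      have h2 := h'.value_le_all j
      have h3 := (hj j).2
      apply Fin.ext
      rw [← permVal_of_lt π (hcn j), ← permVal_of_lt π' (hcn j)]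
      omega
    exact Subtype.ext (Prod.ext hπ rfl)
  · rintro ⟨f, hf⟩
    have h := hf.isShuffle hs (by omega) hmn
    have hpn : ∀ j, n - m - (f j).1 + s < n := fun j => by
      have := h.add_le_length hs j
      omega
    have hwn : ∀ j, n - m - (f j).1 + 1 - (f j).2 < n := fun j => by
      have := hpn j
      omega
    have hmono : StrictMono fun j => n - m - (f j).1 + 1 - (f j).2 :=
      Fin.strictMono_iff_lt_succ.mpr h.value_lt_succ
    obtain ⟨π, hπ, hoff⟩ := exists_perm_strictMonoOn_compl
      (c := fun j => (⟨n - m - (f j).1 + s, hpn j⟩ : Fin n))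
      (w := fun j => (⟨n - m - (f j).1 + 1 - (f j).2, hwn j⟩ : Fin n))
      (fun a b hab => (h.strictMono hs).injective (by
        have := Fin.ext_iff.mp hab
        dsimp only at this ⊢
        omega))
      (fun a b hab => hmono.injective (Fin.ext_iff.mp hab))
    have hval : ∀ j, permVal π (n - m - (f j).1 + s) = n - m - (f j).1 + 1 - (f j).2 := fun j => by
      rw [permVal_of_lt π (hpn j), hπ]
    refine ⟨⟨⟨π, fun j => ⟨n - m - (f j).1, (Nat.le_add_right _ _).trans_lt (hpn j)⟩⟩,
      (isCluster_iff hs hsm hms _ _).mpr ⟨?_, (increasingOff_iff (fun _ => rfl) π).mpr hoff⟩⟩, ?_⟩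
    · simp only [hval]
      exact h
    · apply Subtype.ext
      funext j
      have := hf.bounds j
      simp only [hval]
      exact Prod.ext (by dsimp only; omega) (by dsimp only; omega)

/-! ### The generating function -/

theorem clusterNumber_eq_zero {m n k : ℕ} (σ : Equiv.Perm (Fin m)) (h : k = 0 ∨ n < m) :
    clusterNumber σ n k = 0 := by
  have : IsEmpty {c : Equiv.Perm (Fin n) × (Fin k → Fin n) // IsCluster σ c.1 c.2} := by
    refine ⟨fun c => ?_⟩
    have hk := c.2.pos
    have := c.2.last ⟨k - 1, by omega⟩ (Nat.sub_add_cancel hk)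
    omega
  exact Nat.card_of_isEmpty

theorem clusterOGF_eq_walkSeries {s m : ℕ} (hsm : s + 2 ≤ m) (hms : m ≤ 2 * s) :
    clusterOGF (pattern1324 s m hsm) = tVar * xVar ^ m * walkSeries s m 0 := by
  ext d
  have hd : MvPowerSeries.coeff d (clusterOGF (pattern1324 s m hsm)) =
    clusterNumber (pattern1324 s m hsm) (d 1) (d 0) := rfl
  rw [hd, ← bidegree_eta d]
  generalize d 0 = k
  generalize d 1 = n
  rw [coeff_tVar_mul_xVar_pow_mul, coeff_walkSeries, bidegree_zero, bidegree_one, bidegree_zero,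
    bidegree_one]
  split_ifs with h
  · obtain ⟨k, rfl⟩ := Nat.exists_eq_succ_of_ne_zero (Nat.one_le_iff_ne_zero.mp h.1)
    rw [clusterNumber_succ hsm hms h.2]
    rfl
  · rw [clusterNumber_eq_zero _ (by omega), Nat.cast_zero]

theorem mainTheorem3 (s m : ℕ) (hsm : s + 2 ≤ m) (hms : m ≤ 2 * s) :
    IsUnit (1 - (∑ j ∈ Finset.Icc 1 (m - s - 1), xVar ^ j) * (fussCatalanSubst s - 1)) ∧
    clusterOGF (pattern1324 s m hsm) =
      (xVar ^ (m - s) * (fussCatalanSubst s - 1)) *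
        (1 - (∑ j ∈ Finset.Icc 1 (m - s - 1), xVar ^ j) * (fussCatalanSubst s - 1))⁻¹ := by
  have hs : 0 < s := by omega
  have hunit := isUnit_one_sub_mul_fussCatalanSubst hs (∑ j ∈ Finset.Icc 1 (m - s - 1), xVar ^ j)
  refine ⟨hunit, ?_⟩
  have hV := MvPowerSeries.mul_inv_cancel _
    (MvPowerSeries.isUnit_iff_constantCoeff.mp hunit).ne_zero
  rw [clusterOGF_eq_walkSeries hsm hms, linear_system_solution hs _ (walkSeries s m)
    (walkSeries_eq hs) hV 0, zero_add]
  have hz := fussCatalanSubst_sub_one hs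
  have hm : xVar ^ m = xVar ^ (m - s) * xVar ^ s := by rw [← pow_add, Nat.sub_add_cancel (by omega)]
  generalize (1 - (∑ j ∈ Finset.Icc 1 (m - s - 1), xVar ^ j) * (fussCatalanSubst s - 1))⁻¹ = V
  rw [hz, hm]
  ring
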